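/- Let $\Gamma$ be a finite simple graph with vertex set $\mathbf v$ and edge set $\mathbf e$, with bond dimensions $\mathbf m=(m_e)_{e\in\mathbf e}$ and physical dimensions $\mathbf n=(n_i)_{i\in\mathbf v}$ (non-negative integers). For an edge $e$ let $E_e=\mathbb{C}^{m_e}$, identified with its dual via the standard basis $(e_a)_a$. For a vertex $i$ let $V_i=\mathbb{C}^{n_i}$ and $W_i=\bigotimes_{e\ni i}E_e$. The graph tensor is $$T(\Gamma,\mathbf m)=\bigotimes_{e\in\mathbf e}\mathrm{id}_{E_e}\in\bigotimes_{i\in\mathbf v}W_i,\qquad \mathrm{id}_{E_e}=\sum_{a=1}^{m_e}e_a\otimes e_a,$$ where for each edge the two factors of $\mathrm{id}_{E_e}$ belong to the two endpoints of $e$. The tensor network variety $\mathcal{TNS}^{\Gamma}_{\mathbf m,\mathbf n}\subseteq\bigotimes_{i}V_i$ is the Euclidean closure of the image of the map $$\Phi:\prod_{i}\mathrm{Hom}(W_i,V_i)\to\bigotimes_i V_i,\qquad (X_i)_i\mapsto\Bigl(\bigotimes_i X_i\Bigr)\bigl(T(\Gamma,\mathbf m)\bigr).$$ **Theorem.** Let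 $\Delta$ be the triangle graph on the vertices $0,1,2$, with bond dimensions $\mathbf m=(m_{01},m_{12},m_{02})$ such that $m_{01}\neq m_{02}$, and physical dimensions $\mathbf n=(2,n_1,n_2)$. Assume that every vertex is subcritical, i.e. $2\le m_{01}m_{02}$, $n_1\le m_{01}m_{12}$ and $n_2\le m_{02}m_{12}$. Then the tensor network variety fills the ambient space: $$\mathcal{TNS}^{\Delta}_{\mathbf m,\mathbf n}=\mathbb{C}^2\otimes\mathbb{C}^{n_1}\otimes\mathbb{C}^{n_2}.$$ -/

import Mathlib

open scoped TensorProduct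

/-- The space `W i = ⨂_{e ∋ i} E e` at the vertex `i` of the graph `G`, where `E e = ℂ ^ (m e)` is
the bond space of the edge `e`. Bond spaces are identified with their duals through the standard
(dual) bases, so no orientation of the edges is needed. Only the values of `m` on edges of `G` are
used. -/
abbrev BondSpace {V : Type*} (G : SimpleGraph V) (m : Sym2 V → ℕ) (i : V) : Type _ :=
  ⨂[ℂ] e : G.incidenceSet i, (Fin (m e) → ℂ)

/-- The tensor space `⨂_i ℂ ^ (n i)` of the physical spaces. -/
abbrev PhysicalTensorSpace {V : Type*} (n : V → ℕ) : Type _ :=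
  ⨂[ℂ] i : V, (Fin (n i) → ℂ)

/-- The graph tensor `⨂_e id_{E e}`, regrouped as an element of `⨂_i W i`: since
`id_{E e} = ∑_a e_a ⊗ e_a`, it is the sum over all choices `s` of one basis index for every edge
of the tensors `⨂_i (⨂_{e ∋ i} e_{s e})`. -/
noncomputable def graphTensor {V : Type*} [Fintype V] [DecidableEq V] (G : SimpleGraph V)
    [DecidableRel G.Adj] (m : Sym2 V → ℕ) : ⨂[ℂ] i : V, BondSpace G m i :=
  ∑ s : ((e : G.edgeSet) → Fin (m e)),
    PiTensorProduct.tprod ℂ fun i : V =>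
      PiTensorProduct.tprod ℂ fun e : G.incidenceSet i =>
        (Pi.single (s ⟨e, G.incidenceSet_subset i e.2⟩) 1 : Fin (m e) → ℂ)

/-- The map `Φ (X_i)_i = (⨂_i X_i) (graphTensor)`, for linear maps `X_i : W i → ℂ ^ (n i)`. -/
noncomputable def tensorNetworkMap {V : Type*} [Fintype V] [DecidableEq V] (G : SimpleGraph V)
    [DecidableRel G.Adj] (m : Sym2 V → ℕ) (n : V → ℕ)
    (X : (i : V) → BondSpace G m i →ₗ[ℂ] (Fin (n i) → ℂ)) : PhysicalTensorSpace n :=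
  PiTensorProduct.map X (graphTensor G m)

/-- The tensor network variety: the closure of the image of `tensorNetworkMap` in the Euclidean
topology. On the finite-dimensional complex vector space `PhysicalTensorSpace n` the Euclidean
topology is the module topology. -/
noncomputable def tensorNetworkVariety {V : Type*} [Fintype V] [DecidableEq V] (G : SimpleGraph V)
    [DecidableRel G.Adj] (m : Sym2 V → ℕ) (n : V → ℕ) : Set (PhysicalTensorSpace n) :=
  @closure (PhysicalTensorSpace n) (moduleTopology ℂ (PhysicalTensorSpace n))
    (Set.range (tensorNetworkMap G m n))

/-- All vertices are subcritical: `n i ≤ ∏_{e ∋ i} m e`. -/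
def IsSubcritical {V : Type*} [Fintype V] [DecidableEq V] (G : SimpleGraph V)
    [DecidableRel G.Adj] (m : Sym2 V → ℕ) (n : V → ℕ) : Prop :=
  ∀ i : V, n i ≤ ∏ e ∈ G.incidenceFinset i, m e

/-- The triangle graph on the vertices `0, 1, 2`. -/
abbrev triangleGraph : SimpleGraph (Fin 3) := ⊤

/-! Write a = m₀₁, b = m₁₂, c = m₀₂. Subcriticality at vertices 1 and 2 gives surjections from
ℂ^{ab} and ℂ^{cb} onto the physical spaces, so every tensor comes from a pair of ab × cb matrices.
Pairs of the form P (M_k ⊗ 1_b) Q give tensors of the network, so it is enough that such pairs are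
dense when a ≠ c (`dense_kroneckerOrbit`).

By transposition let a < c. If 2a ≤ c, every pair has this form. Otherwise use a castling transform:
stack a pair into a 2ab × cb matrix. The left annihilator of its columns is generically a pair of
size a'b × ab with a' = 2a - c < a. Kernels of Kronecker pairs are again Kronecker, so density for
(a', a) gives density for (a, c), and the induction descends. For a = c the transform preserves the
shape and nothing descends. -/

open Matrix Kronecker

/-! ### Pencils of Kronecker form -/

/-- Families of matrices of the form `P * (M k ⊗ₖ 1) * Q`. -/
def kroneckerOrbit (κ : Type*) (a b c : ℕ) :
    Set (κ → Matrix (Fin a × Fin b) (Fin c × Fin b) ℂ) :=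
  {K | ∃ (P : Matrix (Fin a × Fin b) (Fin a × Fin b) ℂ) (M : κ → Matrix (Fin a) (Fin c) ℂ)
    (Q : Matrix (Fin c × Fin b) (Fin c × Fin b) ℂ),
      ∀ k, K k = P * (M k ⊗ₖ (1 : Matrix (Fin b) (Fin b) ℂ)) * Q}

/-- Families of matrices of the form `P * (M k ⊗ₖ 1) * Q` with `P` and `Q` invertible. -/
def invertibleKroneckerOrbit (κ : Type*) (a b c : ℕ) :
    Set (κ → Matrix (Fin a × Fin b) (Fin c × Fin b) ℂ) :=
  {K | ∃ (P : Matrix (Fin a × Fin b) (Fin a × Fin b) ℂ) (M : κ → Matrix (Fin a) (Fin c) ℂ)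
    (Q : Matrix (Fin c × Fin b) (Fin c × Fin b) ℂ), P.det ≠ 0 ∧ Q.det ≠ 0 ∧
      ∀ k, K k = P * (M k ⊗ₖ (1 : Matrix (Fin b) (Fin b) ℂ)) * Q}

/-- Along the line `A + z • 1` the determinant is the characteristic polynomial of `-A` at `z`,
which has finitely many roots. -/
theorem Matrix.dense_det_ne_zero {ι : Type*} [Fintype ι] [DecidableEq ι] :
    Dense {A : Matrix ι ι ℂ | A.det ≠ 0} := by
  intro A
  have hfin : {z : ℂ | (-A).charpoly.IsRoot z}.Finite :=
    Polynomial.finite_setOfPred_isRoot (-A).charpoly_monic.ne_zero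
  have h0 : (0 : ℂ) ∈ closure {z : ℂ | (-A).charpoly.IsRoot z}ᶜ :=
    (hfin.countable.dense_compl ℂ) 0
  have hc : Continuous fun z : ℂ => A + z • (1 : Matrix ι ι ℂ) := by fun_prop
  have := map_mem_closure hc h0 (t := {A : Matrix ι ι ℂ | A.det ≠ 0}) (by
    intro z hz
    simp only [Set.mem_compl_iff, Set.mem_ofPred_eq, Polynomial.IsRoot,
      Matrix.eval_charpoly] at hz ⊢
    have hA : A + z • (1 : Matrix ι ι ℂ) = scalar ι z - -A := by
      rw [sub_neg_eq_add, add_comm, smul_one_eq_diagonal, scalar_apply]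
    rwa [hA])
  simpa using this

theorem kroneckerOrbit_subset_closure (κ : Type*) (a b c : ℕ) :
    kroneckerOrbit κ a b c ⊆ closure (invertibleKroneckerOrbit κ a b c) := by
  rintro K ⟨P, M, Q, hK⟩
  obtain rfl : K = fun k => P * (M k ⊗ₖ (1 : Matrix (Fin b) (Fin b) ℂ)) * Q := funext hK
  refine map_mem_closure₂ (f := fun P Q k => P * (M k ⊗ₖ (1 : Matrix (Fin b) (Fin b) ℂ)) * Q)
    ?_ (Matrix.dense_det_ne_zero P) (Matrix.dense_det_ne_zero Q) ?_
  · fun_prop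
  · exact fun P hP Q hQ => ⟨P, M, Q, hP, hQ, fun _ => rfl⟩

theorem transpose_mem_kroneckerOrbit {κ : Type*} {a b c : ℕ}
    {K : κ → Matrix (Fin a × Fin b) (Fin c × Fin b) ℂ} (hK : K ∈ kroneckerOrbit κ a b c) :
    (fun k => (K k)ᵀ) ∈ kroneckerOrbit κ c b a := by
  obtain ⟨P, M, Q, h⟩ := hK
  refine ⟨Qᵀ, fun k => (M k)ᵀ, Pᵀ, fun k => ?_⟩
  change (K k)ᵀ = Qᵀ * ((M k)ᵀ ⊗ₖ (1 : Matrix (Fin b) (Fin b) ℂ)) * Pᵀ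
  rw [h, transpose_mul, transpose_mul, ← kroneckerMap_transpose, transpose_one, Matrix.mul_assoc]

/-- There is room to store all rows of all `K k` in disjoint rows of `Q`; the 0-1 matrix `M k` then
selects those of `K k`, with `P = 1`. -/
theorem kroneckerOrbit_eq_univ {κ : Type*} [Fintype κ] {a c : ℕ} (b : ℕ)
    (h : Fintype.card κ * a ≤ c) : kroneckerOrbit κ a b c = Set.univ := by
  refine Set.eq_univ_of_forall fun K => ?_
  obtain ⟨J⟩ : Nonempty (κ × Fin a ↪ Fin c) :=
    Function.Embedding.nonempty_of_card_le (by simpa using h)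
  refine ⟨1, fun k => Matrix.of fun i x => if J (k, i) = x then 1 else 0,
    Matrix.of fun x y => Function.extend J (fun p => K p.1 (p.2, x.2) y) 0 x.1, fun k => ?_⟩
  ext ⟨i, β⟩ y
  rw [Matrix.one_mul, Matrix.mul_apply, Fintype.sum_prod_type]
  simp [Matrix.one_apply, J.injective.extend_apply]

/-! ### Castling and density -/

/-- A matrix with a right inverse has its kernel covered by as many columns as the difference of
the numbers of columns and rows. -/
theorem Matrix.exists_ker_subset_range {ι α : Type*} [Fintype ι] [DecidableEq ι] [Fintype α]
    [DecidableEq α] {c : ℕ} (A : Matrix α ι ℂ) (W : Matrix ι α ℂ) (hAW : A * W = 1)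
    (hc : Fintype.card ι = Fintype.card α + c) :
    ∃ B : Matrix ι (Fin c) ℂ, ∀ v, A *ᵥ v = 0 → ∃ w, v = B *ᵥ w := by
  have hsurj : LinearMap.range A.mulVecLin = ⊤ := by
    rw [LinearMap.range_eq_top]
    intro y
    exact ⟨W *ᵥ y, by simp [hAW]⟩
  have hrank := A.mulVecLin.finrank_range_add_finrank_ker
  rw [hsurj, finrank_top, Module.finrank_fintype_fun_eq_card,
    Module.finrank_fintype_fun_eq_card] at hrank
  let bas := Module.finBasisOfFinrankEq ℂ (LinearMap.ker A.mulVecLin) (n := c) (by omega)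
  refine ⟨Matrix.of fun i x => (bas x : ι → ℂ) i, fun v hv => ?_⟩
  refine ⟨bas.repr ⟨v, by simpa using hv⟩, ?_⟩
  have := congrArg Subtype.val (bas.sum_repr ⟨v, by simpa using hv⟩)
  ext i
  have := congrFun this i
  simp only [Submodule.coe_sum, Submodule.coe_smul, Finset.sum_apply, Pi.smul_apply,
    smul_eq_mul] at this
  rw [← this, Matrix.mulVec, dotProduct]
  exact Finset.sum_congr rfl fun _ _ => mul_comm _ _

/-- After cancelling `P` and absorbing `Q`, the equations for `L` decouple over the index `β` into
copies of one system, with matrix the row of blocks `M k`. A basis `B` of its kernel supplies the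
new Kronecker factor; `W` forces full rank, so the kernel has dimension `c`. -/
theorem mem_kroneckerOrbit_of_sum_mul_eq_zero {κ : Type*} [Fintype κ] {a a' b c : ℕ}
    (hcard : Fintype.card κ * a = a' + c)
    {K : κ → Matrix (Fin a' × Fin b) (Fin a × Fin b) ℂ}
    (hK : K ∈ invertibleKroneckerOrbit κ a' b a)
    (W : κ → Matrix (Fin a × Fin b) (Fin a' × Fin b) ℂ) (hW : ∑ k, K k * W k = 1)
    (L : κ → Matrix (Fin a × Fin b) (Fin c × Fin b) ℂ) (hL : ∑ k, K k * L k = 0) :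
    L ∈ kroneckerOrbit κ a b c := by
  classical
  obtain ⟨P, M, Q, hP, hQ, hKM⟩ := hK
  rcases isEmpty_or_nonempty (Fin b) with hb | ⟨⟨β₀⟩⟩
  · exact ⟨0, 0, 0, fun k => by ext ⟨_, β⟩; exact hb.elim β⟩
  -- A one-sided inverse of a square matrix is two-sided, so `P` may move to the right.
  have hW' : (∑ k, (M k ⊗ₖ (1 : Matrix (Fin b) (Fin b) ℂ)) * (Q * W k)) * P = 1 := by
    rw [mul_eq_one_comm, ← hW, Matrix.mul_sum]
    simp only [hKM, Matrix.mul_assoc]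
  have hL' : ∑ k, (M k ⊗ₖ (1 : Matrix (Fin b) (Fin b) ℂ)) * (Q * L k) = 0 := by
    have : P⁻¹ * ∑ k, K k * L k = 0 := by rw [hL, Matrix.mul_zero]
    rw [Matrix.mul_sum] at this
    rw [← this]
    refine Finset.sum_congr rfl fun k _ => ?_
    rw [hKM, Matrix.mul_assoc, Matrix.mul_assoc,
      Matrix.nonsing_inv_mul_cancel_left _ _ (isUnit_iff_ne_zero.2 hP)]
  have key : ∀ {ν : Type} [Fintype ν] (Z : κ → Matrix (Fin a × Fin b) ν ℂ) (x : Fin a')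
      (β : Fin b) (y : ν),
      (∑ k, (M k ⊗ₖ (1 : Matrix (Fin b) (Fin b) ℂ)) * Z k) (x, β) y =
        ∑ k, ∑ i, M k x i * Z k (i, β) y := by
    intro ν _ Z x β y
    simp [Matrix.sum_apply, Matrix.mul_apply, Fintype.sum_prod_type, Matrix.one_apply]
  obtain ⟨B, hB⟩ := Matrix.exists_ker_subset_range (c := c)
    (Matrix.of fun (x : Fin a') (p : κ × Fin a) => M p.1 x p.2)
    (Matrix.of fun p y => (Q * (W p.1 * P)) (p.2, β₀) (y, β₀)) (by
      ext x y
      have := congrFun (congrFun hW' (x, β₀)) (y, β₀)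
      rw [Matrix.sum_mul] at this
      simp only [Matrix.mul_assoc _ _ P] at this
      rw [key] at this
      rw [Matrix.mul_apply, Fintype.sum_prod_type]
      simpa [Matrix.one_apply] using this) (by simpa using hcard)
  have hcol : ∀ (β : Fin b) (y : Fin c × Fin b), ∃ w : Fin c → ℂ,
      (fun p : κ × Fin a => (Q * L p.1) (p.2, β) y) = B *ᵥ w := by
    intro β y
    refine hB _ ?_
    ext x
    have := congrFun (congrFun hL' (x, β)) y
    rw [key] at this
    simpa [Matrix.mulVec, dotProduct, Fintype.sum_prod_type] using this
  choose w hw using hcol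
  refine ⟨Q⁻¹, fun k => Matrix.of fun i x => B (k, i) x, Matrix.of fun p y => w p.2 y p.1,
    fun k => ?_⟩
  rw [Matrix.mul_assoc, ← Matrix.nonsing_inv_mul_cancel_left Q (L k) (isUnit_iff_ne_zero.2 hQ)]
  congr 1
  ext ⟨i, β⟩ y
  have := congrFun (hw β y) (k, i)
  simp only at this
  rw [this]
  simp [Matrix.mul_apply, Fintype.sum_prod_type, Matrix.one_apply, Matrix.mulVec, dotProduct]

/-- Complete the stacked pencil to an invertible `N`. The lower rows of `N⁻¹` form a pencil
annihilating it; approximate these by a Kronecker pencil and invert back. -/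
theorem dense_kroneckerOrbit_of_reflection {κ : Type*} [Fintype κ] {a a' b c : ℕ}
    (hcard : Fintype.card κ * a = a' + c) (h : Dense (kroneckerOrbit κ a' b a)) :
    Dense (kroneckerOrbit κ a b c) := by
  classical
  intro K
  obtain ⟨e⟩ : Nonempty (κ × (Fin a × Fin b) ≃ (Fin c × Fin b) ⊕ (Fin a' × Fin b)) := by
    refine ⟨Fintype.equivOfCardEq ?_⟩
    simp only [Fintype.card_prod, Fintype.card_sum, Fintype.card_fin]
    rw [← mul_assoc, hcard]
    ring
  let τ := (Fin c × Fin b) ⊕ (Fin a' × Fin b)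
  let π : Matrix τ τ ℂ → κ → Matrix (Fin a × Fin b) (Fin c × Fin b) ℂ :=
    fun N k => Matrix.of fun z y => N (e (k, z)) (Sum.inl y)
  have hπ : Continuous π :=
    continuous_pi fun k => continuous_matrix fun z y => continuous_id.matrix_elem _ _
  have hinv : ∀ N : Matrix τ τ ℂ, N.det ≠ 0 → π N ∈ closure (kroneckerOrbit κ a b c) := by
    intro N hN
    let K' : κ → Matrix (Fin a' × Fin b) (Fin a × Fin b) ℂ :=
      fun k => Matrix.of fun x z => N⁻¹ (Sum.inr x) (e (k, z))
    -- `ρ` replaces the lower rows of `N⁻¹` by a nearby pencil and keeps the upper rows.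
    let ρ : (κ → Matrix (Fin a' × Fin b) (Fin a × Fin b) ℂ) → Matrix τ τ ℂ := fun A =>
      Matrix.of fun s t => Sum.elim (fun y => N⁻¹ (Sum.inl y) t)
        (fun x => A (e.symm t).1 x (e.symm t).2) s
    have hρ : Continuous ρ := by
      refine continuous_matrix fun s t => ?_
      rcases s with y | x
      · exact continuous_const
      · exact Continuous.matrix_elem
          (A := fun A : κ → Matrix (Fin a' × Fin b) (Fin a × Fin b) ℂ => A (e.symm t).1)
          (continuous_apply _) _ _
    have hρK' : ρ K' = N⁻¹ := by
      ext s t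
      rcases s with y | x
      · rfl
      · simp [ρ, K']
    have hdet : (ρ K').det ≠ 0 := by
      rw [hρK', Matrix.det_nonsing_inv]
      simpa using hN
    have hK' : K' ∈ closure (invertibleKroneckerOrbit κ a' b a) :=
      closure_minimal (kroneckerOrbit_subset_closure κ a' b a) isClosed_closure (h K')
    have hopen : IsOpen {A | (ρ A).det ≠ 0} :=
      isOpen_ne_fun hρ.matrix_det continuous_const
    have hK'' := hopen.inter_closure ⟨hdet, hK'⟩
    have hcont : ContinuousAt (fun A => π (ρ A)⁻¹) K' := by
      refine hπ.continuousAt.comp (ContinuousAt.comp (g := Inv.inv) ?_ hρ.continuousAt)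
      refine continuousAt_matrix_inv _ ?_
      rw [Ring.inverse_eq_inv']
      exact continuousAt_inv₀ hdet
    have hmem := hcont.continuousWithinAt.mem_closure hK'' (t := kroneckerOrbit κ a b c) (by
      rintro A ⟨hA, hAorb⟩
      have hmul : ρ A * (ρ A)⁻¹ = 1 := Matrix.mul_nonsing_inv _ (isUnit_iff_ne_zero.2 hA)
      have hrow : ∀ x t, ∑ k, ∑ z, A k x z * (ρ A)⁻¹ (e (k, z)) t =
          (1 : Matrix τ τ ℂ) (Sum.inr x) t := by
        intro x t
        rw [← hmul, Matrix.mul_apply, ← e.sum_comp, Fintype.sum_prod_type]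
        simp [ρ]
      refine mem_kroneckerOrbit_of_sum_mul_eq_zero hcard hAorb
        (fun k => Matrix.of fun z x => (ρ A)⁻¹ (e (k, z)) (Sum.inr x)) ?_ _ ?_
      · ext x y
        have := hrow x (Sum.inr y)
        simpa [Matrix.sum_apply, Matrix.mul_apply, Matrix.one_apply] using this
      · ext x y
        have := hrow x (Sum.inl y)
        simpa [Matrix.sum_apply, Matrix.mul_apply, Matrix.one_apply, π] using this)
    simpa only [hρK', Matrix.nonsing_inv_nonsing_inv _ (isUnit_iff_ne_zero.2 hN)] using hmem
  -- Padding by zeros suffices: `N₀` need only be a limit of invertible matrices.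
  let N₀ : Matrix τ τ ℂ := Matrix.of fun t s =>
    Sum.elim (fun y => K (e.symm t).1 (e.symm t).2 y) (fun _ => 0) s
  have hN₀ : π N₀ = K := by
    ext k z y
    simp [π, N₀]
  rw [← hN₀, ← closure_closure]
  exact map_mem_closure hπ (Matrix.dense_det_ne_zero N₀) hinv

theorem dense_kroneckerOrbit_of_lt {κ : Type*} [Fintype κ] (hκ : Fintype.card κ = 2) (b : ℕ)
    {a c : ℕ} (hac : a < c) : Dense (kroneckerOrbit κ a b c) := by
  induction a using Nat.strong_induction_on generalizing c with
  | _ a ih =>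
    by_cases h : 2 * a ≤ c
    · rw [kroneckerOrbit_eq_univ b (by rwa [hκ])]
      exact dense_univ
    -- The subtraction is not truncated, since `c < 2 * a`; and `a < c` gives `a' < a`, which serves
    -- both as descent and as the hypothesis for the pair `(a', a)`.
    · exact dense_kroneckerOrbit_of_reflection (a' := 2 * a - c) (by rw [hκ]; omega)
        (ih _ (by omega) (by omega))

theorem dense_kroneckerOrbit {κ : Type*} [Fintype κ] (hκ : Fintype.card κ = 2) (b : ℕ)
    {a c : ℕ} (hac : a ≠ c) : Dense (kroneckerOrbit κ a b c) := by
  rcases hac.lt_or_gt with h | h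
  · exact dense_kroneckerOrbit_of_lt hκ b h
  · intro K
    have hc : Continuous fun (K : κ → Matrix (Fin c × Fin b) (Fin a × Fin b) ℂ) k => (K k)ᵀ := by
      fun_prop
    exact map_mem_closure hc (dense_kroneckerOrbit_of_lt hκ b h fun k => (K k)ᵀ)
      fun _ => transpose_mem_kroneckerOrbit

/-! ### From pencils to tensor networks -/

/-- Each `X i` can be prescribed freely on the product basis of the bond space. -/
theorem sum_tprod_mem_range_tensorNetworkMap {V : Type*} [Fintype V] [DecidableEq V]
    (G : SimpleGraph V) [DecidableRel G.Adj] (m : Sym2 V → ℕ) (n : V → ℕ)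
    (v : (i : V) → ((e : G.incidenceSet i) → Fin (m e)) → Fin (n i) → ℂ) :
    ∑ s : ((e : G.edgeSet) → Fin (m e)), PiTensorProduct.tprod ℂ (fun i : V =>
      v i fun e => s ⟨e, G.incidenceSet_subset i e.2⟩) ∈ Set.range (tensorNetworkMap G m n) := by
  refine ⟨fun i => (Basis.piTensorProduct fun e : G.incidenceSet i =>
    Pi.basisFun ℂ (Fin (m e))).constr ℂ (v i), ?_⟩
  rw [tensorNetworkMap, graphTensor, map_sum]
  refine Finset.sum_congr rfl fun s _ => ?_
  rw [PiTensorProduct.map_tprod]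
  congr 1
  funext i
  rw [← Module.Basis.constr_basis (Basis.piTensorProduct fun e : G.incidenceSet i =>
    Pi.basisFun ℂ (Fin (m e))) ℂ (v i), Basis.piTensorProduct_apply]
  simp only [Pi.basisFun_apply]

/-- The three entries of a dependent family over `Fin 3`. -/
def finThreeFamily {F : Fin 3 → Type*} (u : F 0) (v : F 1) (w : F 2) : (i : Fin 3) → F i
  | 0 => u
  | 1 => v
  | 2 => w

theorem update_finThreeFamily_zero {F : Fin 3 → Type*} (u : F 0) (v : F 1) (w : F 2) (u' : F 0) :
    Function.update (finThreeFamily u' v w) 0 u = finThreeFamily u v w := by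
  funext i
  fin_cases i <;> rfl

theorem update_finThreeFamily_one {F : Fin 3 → Type*} (u : F 0) (v : F 1) (w : F 2) (v' : F 1) :
    Function.update (finThreeFamily u v' w) 1 v = finThreeFamily u v w := by
  funext i
  fin_cases i <;> rfl

theorem update_finThreeFamily_two {F : Fin 3 → Type*} (u : F 0) (v : F 1) (w : F 2) (w' : F 2) :
    Function.update (finThreeFamily u v w') 2 w = finThreeFamily u v w := by
  funext i
  fin_cases i <;> rfl

/-- The trilinear map `(u, v, w) ↦ u ⊗ v ⊗ w` on the physical spaces of a graph on `Fin 3`. -/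
noncomputable def physicalTriple (n : Fin 3 → ℕ) :
    (Fin (n 0) → ℂ) →ₗ[ℂ] (Fin (n 1) → ℂ) →ₗ[ℂ] (Fin (n 2) → ℂ) →ₗ[ℂ] PhysicalTensorSpace n :=
  LinearMap.mk₂ ℂ
    (fun u v =>
      { toFun := fun w => PiTensorProduct.tprod ℂ
          (finThreeFamily (F := fun i => Fin (n i) → ℂ) u v w)
        map_add' := fun w w' => by
          simpa only [update_finThreeFamily_two] using (PiTensorProduct.tprod ℂ).map_update_add
            (finThreeFamily (F := fun i => Fin (n i) → ℂ) u v 0) 2 w w'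
        map_smul' := fun r w => by
          simpa only [update_finThreeFamily_two, RingHom.id_apply] using
            (PiTensorProduct.tprod ℂ).map_update_smul
            (finThreeFamily (F := fun i => Fin (n i) → ℂ) u v 0) 2 r w })
    (fun u u' v => LinearMap.ext fun w => by
      have := (PiTensorProduct.tprod ℂ).map_update_add
        (finThreeFamily (F := fun i => Fin (n i) → ℂ) 0 v w) 0 u u'
      simp only [update_finThreeFamily_zero] at this
      exact this)
    (fun r u v => LinearMap.ext fun w => by
      have := (PiTensorProduct.tprod ℂ).map_update_smul
        (finThreeFamily (F := fun i => Fin (n i) → ℂ) 0 v w) 0 r u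
      simp only [update_finThreeFamily_zero] at this
      exact this)
    (fun u v v' => LinearMap.ext fun w => by
      have := (PiTensorProduct.tprod ℂ).map_update_add
        (finThreeFamily (F := fun i => Fin (n i) → ℂ) u 0 w) 1 v v'
      simp only [update_finThreeFamily_one] at this
      exact this)
    (fun r u v => LinearMap.ext fun w => by
      have := (PiTensorProduct.tprod ℂ).map_update_smul
        (finThreeFamily (F := fun i => Fin (n i) → ℂ) u 0 w) 1 r v
      simp only [update_finThreeFamily_one] at this
      exact this)

theorem physicalTriple_apply (n : Fin 3 → ℕ) (f : (i : Fin 3) → Fin (n i) → ℂ) :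
    physicalTriple n (f 0) (f 1) (f 2) = PiTensorProduct.tprod ℂ f := by
  change PiTensorProduct.tprod ℂ (finThreeFamily (F := fun i => Fin (n i) → ℂ) _ _ _) = _
  congr 1
  funext i
  fin_cases i <;> rfl

/-- The tensor `∑ K k x y • e_k ⊗ p e_x ⊗ q e_y`. -/
noncomputable def pencilToTensor (n : Fin 3 → ℕ) {ι ν : Type*} [Fintype ι] [DecidableEq ι]
    [Fintype ν] [DecidableEq ν] (p : (ι → ℂ) →ₗ[ℂ] Fin (n 1) → ℂ)
    (q : (ν → ℂ) →ₗ[ℂ] Fin (n 2) → ℂ) :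
    (Fin (n 0) → Matrix ι ν ℂ) →ₗ[ℂ] PhysicalTensorSpace n :=
  ∑ k, ∑ x, ∑ y, (Matrix.entryLinearMap ℂ ℂ x y ∘ₗ LinearMap.proj k).smulRight
    (physicalTriple n (Pi.single k 1) (p (Pi.single x 1)) (q (Pi.single y 1)))

theorem Fintype.sum_sum_sum_reverse {α β γ A : Type*} [Fintype α] [Fintype β] [Fintype γ]
    [AddCommMonoid A] (g : α → β → γ → A) :
    ∑ x, ∑ y, ∑ z, g x y z = ∑ z, ∑ y, ∑ x, g x y z := by
  calc ∑ x, ∑ y, ∑ z, g x y z = ∑ x, ∑ z, ∑ y, g x y z :=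
        Finset.sum_congr rfl fun _ _ => Finset.sum_comm
    _ = ∑ z, ∑ x, ∑ y, g x y z := Finset.sum_comm
    _ = ∑ z, ∑ y, ∑ x, g x y z := Finset.sum_congr rfl fun _ _ => Finset.sum_comm

theorem pencilToTensor_vecMulVec (n : Fin 3 → ℕ) {ι ν : Type*} [Fintype ι] [DecidableEq ι]
    [Fintype ν] [DecidableEq ν] (p : (ι → ℂ) →ₗ[ℂ] Fin (n 1) → ℂ)
    (q : (ν → ℂ) →ₗ[ℂ] Fin (n 2) → ℂ) (u : Fin (n 0) → ℂ) (v : ι → ℂ) (w : ν → ℂ) :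
    pencilToTensor n p q (fun k => Matrix.of fun x y => u k * v x * w y) =
      physicalTriple n u (p v) (q w) := by
  conv_rhs => rw [pi_eq_sum_univ' u, pi_eq_sum_univ' v, pi_eq_sum_univ' w]
  simp only [map_sum, map_smul, LinearMap.sum_apply, LinearMap.smul_apply]
  simp only [pencilToTensor, LinearMap.sum_apply, LinearMap.smulRight_apply, LinearMap.comp_apply,
    LinearMap.proj_apply, Matrix.entryLinearMap_apply, Matrix.of_apply, Finset.smul_sum, smul_smul]
  rw [Fintype.sum_sum_sum_reverse]
  refine Finset.sum_congr rfl fun _ _ => Finset.sum_congr rfl fun _ _ =>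
    Finset.sum_congr rfl fun _ _ => ?_
  congr 1
  ring

theorem pencilToTensor_surjective (n : Fin 3 → ℕ) {ι ν : Type*} [Fintype ι] [DecidableEq ι]
    [Fintype ν] [DecidableEq ν] {p : (ι → ℂ) →ₗ[ℂ] Fin (n 1) → ℂ}
    {q : (ν → ℂ) →ₗ[ℂ] Fin (n 2) → ℂ} (hp : Function.Surjective p) (hq : Function.Surjective q) :
    Function.Surjective (pencilToTensor n p q) := by
  rw [← LinearMap.range_eq_top, eq_top_iff, ← PiTensorProduct.span_tprod_eq_top, Submodule.span_le]
  rintro _ ⟨f, rfl⟩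
  obtain ⟨v, hv⟩ := hp (f 1)
  obtain ⟨w, hw⟩ := hq (f 2)
  refine ⟨_, pencilToTensor_vecMulVec n p q (f 0) v w |>.trans ?_⟩
  rw [hv, hw, physicalTriple_apply]

theorem triangleGraph_mem_incidenceSet {i j : Fin 3} (h : i ≠ j) :
    s(i, j) ∈ triangleGraph.incidenceSet i :=
  ⟨h, Sym2.mem_mk_left i j⟩

theorem triangleGraph_sum_eq (m : Sym2 (Fin 3) → ℕ) {A : Type*} [AddCommMonoid A]
    (g : Fin (m s(0, 1)) → Fin (m s(1, 2)) → Fin (m s(0, 2)) → A) :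
    ∑ s : ((e : triangleGraph.edgeSet) → Fin (m e)),
      g (s ⟨s(0, 1), by simp⟩) (s ⟨s(1, 2), by simp⟩) (s ⟨s(0, 2), by simp⟩) =
        ∑ α, ∑ β, ∑ γ, g α β γ := by
  trans ∑ p : (Fin (m s(0, 1)) × Fin (m s(1, 2))) × Fin (m s(0, 2)), g p.1.1 p.1.2 p.2
  swap
  · simp only [Fintype.sum_prod_type]
  refine Fintype.sum_bijective (fun s : ((e : triangleGraph.edgeSet) → Fin (m e)) =>
    ((s ⟨s(0, 1), by simp⟩, s ⟨s(1, 2), by simp⟩), s ⟨s(0, 2), by simp⟩)) ?_ _ _ fun _ => rfl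
  have hcases : ∀ e : triangleGraph.edgeSet, e = ⟨s(0, 1), by simp⟩ ∨ e = ⟨s(1, 2), by simp⟩ ∨
      e = ⟨s(0, 2), by simp⟩ := by decide
  constructor
  · intro s t hst
    simp only [Prod.mk.injEq] at hst
    funext e
    rcases hcases e with rfl | rfl | rfl
    · exact hst.1.1
    · exact hst.1.2
    · exact hst.2
  · rintro ⟨⟨α, β⟩, γ⟩
    refine ⟨fun e => if h : e = ⟨s(0, 1), by simp⟩ then Fin.cast (by rw [h]) α
      else if h : e = ⟨s(1, 2), by simp⟩ then Fin.cast (by rw [h]) β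
      else Fin.cast (by rw [((hcases e).resolve_left ‹_›).resolve_left h]) γ, ?_⟩
    simp

/-- In the expansion of P (M_k ⊗ 1) Q the summation indices `α`, `β`, `γ` are the three bonds: `M`,
`P`, `Q` sit at vertices 0, 1, 2, and the identity factor is the bond between 1 and 2. -/
theorem pencilToTensor_mem_range (m : Sym2 (Fin 3) → ℕ) (n : Fin 3 → ℕ)
    (p : (Fin (m s(0, 1)) × Fin (m s(1, 2)) → ℂ) →ₗ[ℂ] Fin (n 1) → ℂ)
    (q : (Fin (m s(0, 2)) × Fin (m s(1, 2)) → ℂ) →ₗ[ℂ] Fin (n 2) → ℂ)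
    {K : Fin (n 0) → Matrix (Fin (m s(0, 1)) × Fin (m s(1, 2)))
      (Fin (m s(0, 2)) × Fin (m s(1, 2))) ℂ}
    (hK : K ∈ kroneckerOrbit (Fin (n 0)) (m s(0, 1)) (m s(1, 2)) (m s(0, 2))) :
    pencilToTensor n p q K ∈ Set.range (tensorNetworkMap triangleGraph m n) := by
  obtain ⟨P, M, Q, hK⟩ := hK
  have hsum : K = ∑ α, ∑ β, ∑ γ, fun k => Matrix.of fun x y =>
      M k α γ * P x (α, β) * Q (γ, β) y := by
    funext k
    ext x y
    simp only [hK, Matrix.mul_apply, Fintype.sum_prod_type, Finset.sum_apply, Matrix.sum_apply,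
      kroneckerMap_apply, Matrix.one_apply, Matrix.of_apply]
    simp only [mul_ite, mul_one, mul_zero, Finset.sum_ite_eq', Finset.mem_univ,
      if_true, Finset.sum_mul]
    rw [Fintype.sum_sum_sum_reverse]
    refine Finset.sum_congr rfl fun _ _ => Finset.sum_congr rfl fun _ _ =>
      Finset.sum_congr rfl fun _ _ => ?_
    ring
  rw [hsum]
  simp only [map_sum]
  simp only [pencilToTensor_vecMulVec n p q (fun k => M k _ _) (fun x => P x _) (fun y => Q _ y)]
  rw [← triangleGraph_sum_eq m fun α β γ => physicalTriple n (fun k => M k α γ)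
    (p fun x => P x (α, β)) (q fun y => Q (γ, β) y)]
  have h10 : s(0, 1) ∈ triangleGraph.incidenceSet 1 :=
    Sym2.eq_swap (a := (1 : Fin 3)) (b := 0) ▸ triangleGraph_mem_incidenceSet (by decide)
  have h20 : s(0, 2) ∈ triangleGraph.incidenceSet 2 :=
    Sym2.eq_swap (a := (2 : Fin 3)) (b := 0) ▸ triangleGraph_mem_incidenceSet (by decide)
  have h21 : s(1, 2) ∈ triangleGraph.incidenceSet 2 :=
    Sym2.eq_swap (a := (2 : Fin 3)) (b := 1) ▸ triangleGraph_mem_incidenceSet (by decide)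
  have := sum_tprod_mem_range_tensorNetworkMap triangleGraph m n <| finThreeFamily
    (fun s k => M k (s ⟨s(0, 1), triangleGraph_mem_incidenceSet (by decide)⟩)
      (s ⟨s(0, 2), triangleGraph_mem_incidenceSet (by decide)⟩))
    (fun s => p fun x => P x (s ⟨s(0, 1), h10⟩,
      s ⟨s(1, 2), triangleGraph_mem_incidenceSet (by decide)⟩))
    (fun s => q fun y => Q (s ⟨s(0, 2), h20⟩, s ⟨s(1, 2), h21⟩) y)
  simp only [← physicalTriple_apply] at this
  exact this

theorem exists_surjective_linearMap {ι : Type*} [Fintype ι] {d : ℕ} (h : d ≤ Fintype.card ι) :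
    ∃ p : (ι → ℂ) →ₗ[ℂ] Fin d → ℂ, Function.Surjective p := by
  obtain ⟨f⟩ : Nonempty (Fin d ↪ ι) := Function.Embedding.nonempty_of_card_le (by simpa using h)
  exact ⟨LinearMap.funLeft ℂ ℂ f, LinearMap.funLeft_surjective_of_injective _ _ _ f.injective⟩

theorem mainTheorem2 (m : Sym2 (Fin 3) → ℕ) (n : Fin 3 → ℕ)
    (hn : n 0 = 2)
    (hm : m s(0, 1) ≠ m s(0, 2))
    (hsub : IsSubcritical triangleGraph m n) :
    tensorNetworkVariety triangleGraph m n = Set.univ := by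
  have hinc1 : triangleGraph.incidenceFinset 1 = {s(0, 1), s(1, 2)} := by decide
  have hinc2 : triangleGraph.incidenceFinset 2 = {s(0, 2), s(1, 2)} := by decide
  have h1 : n 1 ≤ m s(0, 1) * m s(1, 2) := by
    have := hsub 1
    rwa [hinc1, Finset.prod_pair (by decide)] at this
  have h2 : n 2 ≤ m s(0, 2) * m s(1, 2) := by
    have := hsub 2
    rwa [hinc2, Finset.prod_pair (by decide)] at this
  obtain ⟨p, hp⟩ := exists_surjective_linearMap (ι := Fin (m s(0, 1)) × Fin (m s(1, 2)))
    (d := n 1) (by simpa using h1)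
  obtain ⟨q, hq⟩ := exists_surjective_linearMap (ι := Fin (m s(0, 2)) × Fin (m s(1, 2)))
    (d := n 2) (by simpa using h2)
  let : TopologicalSpace (PhysicalTensorSpace n) := moduleTopology ℂ (PhysicalTensorSpace n)
  have : IsModuleTopology ℂ (PhysicalTensorSpace n) := ⟨rfl⟩
  have : ContinuousSMul ℂ (PhysicalTensorSpace n) := ModuleTopology.continuousSMul ℂ _
  have : IsTopologicalAddGroup (PhysicalTensorSpace n) :=
    IsModuleTopology.topologicalAddGroup ℂ _
  have hcont : Continuous (pencilToTensor n p q) :=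
    LinearMap.continuous_of_finiteDimensional _
  refine Set.eq_univ_of_forall fun t => ?_
  obtain ⟨K, rfl⟩ := pencilToTensor_surjective n hp hq t
  exact map_mem_closure hcont
    (dense_kroneckerOrbit (by rw [Fintype.card_fin, hn]) (m s(1, 2)) hm K)
    fun _ => pencilToTensor_mem_range m n p q
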